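/- A coloring $c$ of the vertices of a graph is nonrepetitive if the graph has no path $u_1,\dots,u_{2l}$ with $l\ge 1$ such that $c(u_i)=c(u_{l+i})$ for all $1\le i\le l$. Let $k\ge 0$ be an integer. In the online $k$-tree process, the initial graph $G_0$ is the complete graph on $k+1$ vertices, and in each step $t=1,2,\dots$ the graph $G_t$ is obtained from $G_{t-1}$ by adding a new vertex $v_t$ and joining it to exactly the vertices of some clique of size $k$ in $G_{t-1}$ (so every $G_t$ is a $k$-tree). The vertices of $G_0$ are colored at the start, and each $v_t$ must be colored as soon as it arrives, knowing only the graphs $G_0,\dots,G_t$; no vertex is ever recolored. Theorem 1. For every $k\ge 0$ there is an online coloring strategy using at most $4^k$ colors such that, whichever cliques are chosen during the process (which may be finite or infinite), for every $t$ the graph $G_t$ is nonrepetitively colored at time $t$. -/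

import Mathlib

/-- A sequence is a repetition if it is of the form `x₁ … x_l x₁ … x_l` with `l ≥ 1`. -/
def IsRepetition {α : Type*} (s : List α) : Prop :=
  ∃ w : List α, w ≠ [] ∧ s = w ++ w

/-- A coloring `c` of the vertices of `G` is nonrepetitive if the sequence of colors along any
(finite, not necessarily induced) path of `G` is not a repetition. -/
def IsNonrepetitive {V : Type*} {α : Type*} (G : SimpleGraph V) (c : V → α) : Prop :=
  ∀ (u v : V) (p : G.Walk u v), p.IsPath → ¬ IsRepetition (p.support.map c)

/-- What is revealed in one step of an online process: the set of previous vertices to which the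
new vertex is joined, and the set of old edges that are deleted. -/
structure OnlineStep where
  nbrs : Finset ℕ
  deleted : Set (Sym2 ℕ)

/-- The graph obtained from `G` by deleting the edges in `s.deleted` and joining the new vertex
`v` to the vertices in `s.nbrs`. -/
def extendGraph (G : SimpleGraph ℕ) (v : ℕ) (s : OnlineStep) : SimpleGraph ℕ :=
  G.deleteEdges s.deleted ⊔ SimpleGraph.fromRel (fun a b => a = v ∧ b ∈ s.nbrs)

/-- The graph after `t` steps of the online process that starts with the graph `G₀` on the
vertices `0, …, n₀ - 1`. Vertices are numbered by their order of arrival, so the new vertex of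
step number `t` (counted from `0`) is `n₀ + t`, and the vertices present after `t` steps are
`0, …, n₀ + t - 1`. The graph is kept on the vertex type `ℕ`, where vertices which have not
arrived yet are isolated (hence lie on no path with more than one vertex). -/
def onlineGraph (n₀ : ℕ) (G₀ : SimpleGraph ℕ) (S : ℕ → OnlineStep) : ℕ → SimpleGraph ℕ
  | 0 => G₀
  | t + 1 => extendGraph (onlineGraph n₀ G₀ S t) (n₀ + t) (S t)

/-- A step applied to the graph `G` on the vertices `0, …, n - 1` obeys the general rules of the
online model, and the restriction `R` on the new vertex's neighbors and the deleted edges. -/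
def IsLegalStep (R : ℕ → SimpleGraph ℕ → OnlineStep → Prop)
    (n : ℕ) (G : SimpleGraph ℕ) (s : OnlineStep) : Prop :=
  s.nbrs ⊆ Finset.range n ∧ s.deleted ⊆ G.edgeSet ∧ R n G s

/-- A (deterministic) online coloring strategy: colors for the `n₀` vertices of the initial graph,
and, for every nonempty history of steps, in chronological order, the color given to the vertex
that arrived in the last of them. -/
structure OnlineStrategy (n₀ : ℕ) (α : Type*) where
  init : Fin n₀ → α
  respond : List OnlineStep → α

/-- The coloring produced by a strategy against the steps `S 0, S 1, …`. The vertex `n₀ + t` gets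
a color that depends only on `S 0, …, S t`, and that never changes afterwards. -/
def OnlineStrategy.coloring {n₀ : ℕ} {α : Type*} (σ : OnlineStrategy n₀ α)
    (S : ℕ → OnlineStep) (v : ℕ) : α :=
  if h : v < n₀ then σ.init ⟨v, h⟩ else σ.respond ((List.range (v - n₀ + 1)).map S)

/-- The graphs generated from the initial graph `G₀` on the vertices `0, …, n₀ - 1` under the
restriction `R` can be colored nonrepetitively online with colors from `α`: some strategy keeps
the current graph nonrepetitively colored at all times `t`, no matter which legal steps have been
made so far (the process may be finite or infinite). -/
def OnlineNonrepetitivelyColorable (n₀ : ℕ) (G₀ : SimpleGraph ℕ)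
    (R : ℕ → SimpleGraph ℕ → OnlineStep → Prop) (α : Type*) : Prop :=
  ∃ σ : OnlineStrategy n₀ α, ∀ (S : ℕ → OnlineStep) (t : ℕ),
    (∀ i < t, IsLegalStep R (n₀ + i) (onlineGraph n₀ G₀ S i) (S i)) →
      IsNonrepetitive (onlineGraph n₀ G₀ S t) (σ.coloring S)

/-- The complete graph on the vertices `0, …, n - 1` (all other naturals are isolated). -/
def initialComplete (n : ℕ) : SimpleGraph ℕ where
  Adj a b := a ≠ b ∧ a < n ∧ b < n
  symm := ⟨fun _ _ h => ⟨h.1.symm, h.2.2, h.2.1⟩⟩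
  loopless := ⟨fun _ h => h.1 rfl⟩

/-- The restriction for online `k`-trees: the new vertex is joined to the vertices of a `k`-clique
of the current graph, and no edge is deleted. -/
def KTreeStep (k : ℕ) (_n : ℕ) (G : SimpleGraph ℕ) (s : OnlineStep) : Prop :=
  G.IsNClique k s.nbrs ∧ s.deleted = ∅

/-!
The idea is the one by which Kündgen and Pelsmajer color `k`-trees with `4 ^ k` colors, in a form in
which the color of a vertex depends only on the past.

Call a graph built vertex by vertex, each new vertex being joined to a clique of at most `k` older
ones, a clique construction (`IsCliqueConstruction`); a `k`-tree process is one, and its initial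
complete graph too. Give a new vertex level `0` if it has no older neighbor, and otherwise one more
than the least level among its older neighbors. As these form a clique, they lie on the vertex's own
level and the one below, and at least one lies below. Hence the edges within levels form a clique
construction with at most `k - 1` older neighbors per vertex, and the color of a vertex is the pair
of a letter that depends on its level and its color in that smaller construction. With four letters
this makes `4 ^ k` colors (`levelColor`).

The letters come from an infinite word that is square-free (`levelWord_squareFree`) and in which any
three consecutive letters are distinct. It follows that a lazy walk on the levels that reads the same
word in its first and its second half visits the same levels in both (`eq_of_isChain_near`):
deleting simultaneous stays and reversals makes the two halves monotone, and then they would yield a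
square or a short palindrome unless they agree. So along a path whose color sequence is a repetition,
the levels repeat as well. The vertices of the path on its lowest level again form a path
(`IsCliqueConstruction.isChain_filter_level`): the latest vertex above that level is joined to a
clique of older vertices containing its neighbors on the path, so it can be left out, and so on. The
colors along this path form a repetition in the smaller construction, and induction on `k` ends the
proof (`IsCliqueConstruction.eq_nil_of_forall₂`).
-/

/-! ### A square-free word on four letters in which close letters differ -/

/-- The Thue–Morse sequence, the parity of the binary digit sum of `n`. -/
def thueMorse : ℕ → ℕ
  | 0 => 0
  | n + 1 => (thueMorse ((n + 1) / 2) + (n + 1)) % 2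

theorem thueMorse_lt (n : ℕ) : thueMorse n < 2 := by
  cases n <;> rw [thueMorse] <;> omega

theorem thueMorse_two_mul (n : ℕ) : thueMorse (2 * n) = thueMorse n := by
  rcases n with _ | n
  · rfl
  · have h := thueMorse_lt (n + 1)
    rw [show 2 * (n + 1) = 2 * n + 1 + 1 by ring, thueMorse,
      show (2 * n + 1 + 1) / 2 = n + 1 by omega]
    omega

theorem thueMorse_two_mul_add_one (n : ℕ) : thueMorse (2 * n + 1) = 1 - thueMorse n := by
  have h := thueMorse_lt n
  rw [thueMorse, show (2 * n + 1) / 2 = n by omega]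
  omega

/-- The Thue–Morse sequence is overlap-free. An even period is halved; under an odd period the
inequality of the terms `2 * n` and `2 * n + 1` spreads to all pairs of consecutive terms, so that
the sequence alternates, which contradicts the odd period. -/
theorem thueMorse_overlapFree (p : ℕ) (hp : 0 < p) (s : ℕ) :
    ¬ ∀ i ≤ p, thueMorse (s + i) = thueMorse (s + p + i) := by
  induction p using Nat.strong_induction_on generalizing s with
  | _ p ih =>
    intro h
    obtain ⟨q, rfl | rfl⟩ := Nat.even_or_odd' p
    · refine ih q (by omega) (by omega) (s / 2) fun i hi => ?_
      have h1 := h (2 * i) (by omega)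
      have l1 := thueMorse_lt (s / 2 + i)
      have l2 := thueMorse_lt (s / 2 + q + i)
      obtain ⟨r, rfl | rfl⟩ := Nat.even_or_odd' s
      · rw [show 2 * r + 2 * i = 2 * (2 * r / 2 + i) by omega,
          show 2 * r + 2 * q + 2 * i = 2 * (2 * r / 2 + q + i) by omega,
          thueMorse_two_mul, thueMorse_two_mul] at h1
        exact h1
      · rw [show 2 * r + 1 + 2 * i = 2 * ((2 * r + 1) / 2 + i) + 1 by omega,
          show 2 * r + 1 + 2 * q + 2 * i = 2 * ((2 * r + 1) / 2 + q + i) + 1 by omega,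
          thueMorse_two_mul_add_one, thueMorse_two_mul_add_one] at h1
        omega
    · have hpair : ∀ n, thueMorse (2 * n) ≠ thueMorse (2 * n + 1) := fun n => by
        have := thueMorse_lt n
        rw [thueMorse_two_mul, thueMorse_two_mul_add_one]
        omega
      have halt : ∀ i ≤ 2 * q, thueMorse (s + i) ≠ thueMorse (s + (i + 1)) := by
        intro i hi
        obtain ⟨r, hr | hr⟩ := Nat.even_or_odd' (s + i)
        · rw [← add_assoc, hr]
          exact hpair r
        · rw [h i (by omega), h (i + 1) (by omega),
            show s + (2 * q + 1) + i = 2 * (r + q + 1) by omega,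
            show s + (2 * q + 1) + (i + 1) = 2 * (r + q + 1) + 1 by omega]
          exact hpair _
      have hpar : ∀ j ≤ 2 * q + 1, (thueMorse (s + j) + thueMorse s + j) % 2 = 0 := by
        intro j hj
        induction j with
        | zero => simp only [add_zero]; omega
        | succ j ihj =>
          have h1 := ihj (by omega)
          have h2 := halt j (by omega)
          have l1 := thueMorse_lt (s + j)
          have l2 := thueMorse_lt (s + (j + 1))
          omega
      have h1 := hpar (2 * q + 1) le_rfl
      have h2 := h 0 (by omega)
      simp only [add_zero] at h2
      omega

/-- The ternary Thue word: the differences of consecutive terms of the Thue–Morse sequence, shifted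
by one so as to lie in `{0, 1, 2}`. -/
def thueWord (n : ℕ) : ℕ := thueMorse (n + 1) + 1 - thueMorse n

/-- Equal differences make `thueMorse (s + p + i) - thueMorse (s + i)` independent of `i ≤ p`. If it
is `0` there is an overlap; if it is `±1` then the term at `s + p` is both `0` and `1`. -/
theorem thueWord_squareFree (p : ℕ) (hp : 0 < p) (s : ℕ) :
    ¬ ∀ i < p, thueWord (s + i) = thueWord (s + p + i) := by
  intro h
  have hconst : ∀ i ≤ p, thueMorse (s + p + i) + thueMorse s
      = thueMorse (s + i) + thueMorse (s + p) := by
    intro i hi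
    induction i with
    | zero => simp only [add_zero]; omega
    | succ i ih =>
      have h1 := h i (by omega)
      have h2 := ih (by omega)
      have l1 := thueMorse_lt (s + i)
      have l2 := thueMorse_lt (s + p + i)
      simp only [thueWord, ← add_assoc] at h1 h2 ⊢
      omega
  have h1 := hconst p le_rfl
  have l1 := thueMorse_lt s
  have l2 := thueMorse_lt (s + p)
  have l3 := thueMorse_lt (s + p + p)
  refine thueMorse_overlapFree p hp s fun i hi => ?_
  have h2 := hconst i hi
  omega

/-- The ternary Thue word with the fourth letter `3` inserted at the multiples of three. -/
def levelWord (n : ℕ) : ℕ := if n % 3 = 0 then 3 else thueWord (2 * (n / 3) + (n % 3 - 1))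

theorem thueWord_lt (n : ℕ) : thueWord n < 3 := by
  have := thueMorse_lt (n + 1)
  simp only [thueWord]
  omega

theorem levelWord_lt (n : ℕ) : levelWord n < 4 := by
  have := thueWord_lt (2 * (n / 3) + (n % 3 - 1))
  unfold levelWord
  split_ifs <;> omega

theorem thueWord_ne_succ (n : ℕ) : thueWord n ≠ thueWord (n + 1) := fun h =>
  thueWord_squareFree 1 one_pos n fun i hi => by
    obtain rfl : i = 0 := by omega
    simpa using h

theorem levelWord_three_mul (q : ℕ) : levelWord (3 * q) = 3 := by
  simp [levelWord]

theorem levelWord_thueWord (m : ℕ) : levelWord (3 * (m / 2) + m % 2 + 1) = thueWord m := by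
  rw [levelWord, if_neg (by omega)]
  congr 1
  omega

theorem levelWord_ne_succ (n : ℕ) : levelWord n ≠ levelWord (n + 1) := by
  have h0 := thueWord_lt (2 * (n / 3))
  have h1 := thueWord_lt (2 * (n / 3) + 1)
  have h2 := thueWord_ne_succ (2 * (n / 3))
  have a := levelWord_thueWord (2 * (n / 3))
  have b := levelWord_thueWord (2 * (n / 3) + 1)
  have c := levelWord_three_mul (n / 3)
  have d := levelWord_three_mul (n / 3 + 1)
  rw [show 3 * (2 * (n / 3) / 2) + 2 * (n / 3) % 2 + 1 = 3 * (n / 3) + 1 by omega] at a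
  rw [show 3 * ((2 * (n / 3) + 1) / 2) + (2 * (n / 3) + 1) % 2 + 1 = 3 * (n / 3) + 2 by omega] at b
  obtain hn | hn | hn : n = 3 * (n / 3) ∨ n = 3 * (n / 3) + 1 ∨ n = 3 * (n / 3) + 2 := by omega
  · rw [hn, c, a]; omega
  · rw [hn, a, b]; omega
  · rw [hn, b, show 3 * (n / 3) + 2 + 1 = 3 * (n / 3 + 1) by ring, d]; omega

theorem levelWord_ne_add_two (n : ℕ) : levelWord n ≠ levelWord (n + 2) := by
  have h0 := thueWord_lt (2 * (n / 3) + 1)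
  have h1 := thueWord_lt (2 * (n / 3))
  have h2 := thueWord_ne_succ (2 * (n / 3) + 1)
  have a := levelWord_thueWord (2 * (n / 3))
  have b := levelWord_thueWord (2 * (n / 3) + 1)
  have b' := levelWord_thueWord (2 * (n / 3) + 1 + 1)
  have c := levelWord_three_mul (n / 3)
  have d := levelWord_three_mul (n / 3 + 1)
  rw [show 3 * (2 * (n / 3) / 2) + 2 * (n / 3) % 2 + 1 = 3 * (n / 3) + 1 by omega] at a
  rw [show 3 * ((2 * (n / 3) + 1) / 2) + (2 * (n / 3) + 1) % 2 + 1 = 3 * (n / 3) + 2 by omega] at b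
  rw [show 3 * ((2 * (n / 3) + 1 + 1) / 2) + (2 * (n / 3) + 1 + 1) % 2 + 1
    = 3 * (n / 3) + 2 + 2 by omega] at b'
  obtain hn | hn | hn : n = 3 * (n / 3) ∨ n = 3 * (n / 3) + 1 ∨ n = 3 * (n / 3) + 2 := by omega
  · rw [hn, c, b]; omega
  · rw [hn, a, show 3 * (n / 3) + 1 + 2 = 3 * (n / 3 + 1) by ring, d]; omega
  · rw [hn, b, b']; exact h2

/-- The letter `3` forces the period of a square to be a multiple `3 * q` of three, and then erasing
that letter leaves a square of period `2 * q` in the Thue word. -/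
theorem levelWord_squareFree (p : ℕ) (hp : 0 < p) (s : ℕ) :
    ¬ ∀ i < p, levelWord (s + i) = levelWord (s + p + i) := by
  intro h
  obtain rfl | rfl | hp3 : p = 1 ∨ p = 2 ∨ 3 ≤ p := by omega
  · exact levelWord_ne_succ s (h 0 (by omega))
  · exact levelWord_ne_add_two s (h 0 (by omega))
  have hdvd : ∃ q, p = 3 * q := by
    have h1 := h (3 * ((s + 2) / 3) - s) (by omega)
    rw [show s + (3 * ((s + 2) / 3) - s) = 3 * ((s + 2) / 3) by omega, levelWord_three_mul,
      levelWord] at h1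
    split_ifs at h1 with h2
    · exact ⟨p / 3, by omega⟩
    · exact absurd h1.symm (thueWord_lt _).ne
  obtain ⟨q, rfl⟩ := hdvd
  refine thueWord_squareFree (2 * q) (by omega) (2 * (s / 3) + (s % 3 - 1)) fun j hj => ?_
  set m := 2 * (s / 3) + (s % 3 - 1) + j with hm
  have h1 := h (3 * (m / 2) + m % 2 + 1 - s) (by omega)
  rw [show s + (3 * (m / 2) + m % 2 + 1 - s) = 3 * (m / 2) + m % 2 + 1 by omega,
    show s + 3 * q + (3 * (m / 2) + m % 2 + 1 - s)
      = 3 * ((m + 2 * q) / 2) + (m + 2 * q) % 2 + 1 by omega,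
    levelWord_thueWord, levelWord_thueWord] at h1
  rw [h1]
  congr 1
  omega

/-! ### Lazy walks whose two halves read the same word -/

/-- Two levels are near if they are equal or consecutive. -/
def Near (a b : ℕ) : Prop := a ≤ b + 1 ∧ b ≤ a + 1

theorem levelWord_inj {a b : ℕ} (h1 : a ≤ b + 2) (h2 : b ≤ a + 2)
    (h : levelWord a = levelWord b) : a = b := by
  by_contra hne
  obtain rfl | rfl | rfl | rfl : b = a + 1 ∨ b = a + 2 ∨ a = b + 1 ∨ a = b + 2 := by omega
  · exact levelWord_ne_succ _ h
  · exact levelWord_ne_add_two _ h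
  · exact levelWord_ne_succ _ h.symm
  · exact levelWord_ne_add_two _ h.symm

/-- Two pairs of levels are near if they are so in both coordinates. -/
def NearPair (p q : ℕ × ℕ) : Prop := Near p.1 q.1 ∧ Near p.2 q.2

/-- The pair `q` is one step away from `p` in each coordinate; `u` and `v` tell whether the first
and the second coordinate goes up. -/
def StepPair (u v : Bool) (p q : ℕ × ℕ) : Prop :=
  (if u then q.1 = p.1 + 1 else p.1 = q.1 + 1) ∧ (if v then q.2 = p.2 + 1 else p.2 = q.2 + 1)

/-- Two parallel lazy walks that read the same word both stay or both move at each step, and both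
or neither return to their previous but one position. So if there is no place where both stay and
none where both turn back, each of them is monotone. -/
theorem reducible_or_monotone (Z : List (ℕ × ℕ)) (hf : ∀ p ∈ Z, levelWord p.1 = levelWord p.2)
    (hZ : Z.IsChain NearPair) :
    (∃ Z₁ p Z₂, Z = Z₁ ++ p :: p :: Z₂) ∨ (∃ Z₁ p q Z₂, Z = Z₁ ++ p :: q :: p :: Z₂) ∨
      ∃ u v, Z.IsChain (StepPair u v) := by
  induction Z with
  | nil => exact .inr (.inr ⟨true, true, .nil⟩)
  | cons p Z ih =>
    rcases Z with _ | ⟨q, Z⟩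
    · exact .inr (.inr ⟨true, true, .singleton _⟩)
    rw [List.isChain_cons_cons] at hZ
    rcases ih (fun r hr => hf r (List.mem_cons_of_mem _ hr)) hZ.2 with
      ⟨Z₁, r, Z₂, h⟩ | ⟨Z₁, r, r', Z₂, h⟩ | ⟨u, v, h⟩
    · exact .inl ⟨p :: Z₁, r, Z₂, by rw [h]; rfl⟩
    · exact .inr (.inl ⟨p :: Z₁, r, r', Z₂, by rw [h]; rfl⟩)
    obtain ⟨⟨⟨h1, h2⟩, h3, h4⟩, hZ⟩ := hZ
    have fp := hf p (by simp)
    have fq := hf q (by simp)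
    by_cases hpq : p = q
    · subst hpq
      exact .inl ⟨[], p, Z, rfl⟩
    have hne1 : p.1 ≠ q.1 := fun e => hpq <| Prod.ext e <|
      levelWord_inj (by omega) (by omega) (by rw [← fp, ← fq, e])
    have hne2 : p.2 ≠ q.2 := fun e => hpq <| Prod.ext
      (levelWord_inj (by omega) (by omega) (by rw [fp, fq, e])) e
    rcases Z with _ | ⟨r, Z⟩
    · refine .inr (.inr ⟨decide (p.1 < q.1), decide (p.2 < q.2), ?_⟩)
      simp only [List.isChain_cons_cons, List.isChain_singleton, and_true, StepPair,
        decide_eq_true_eq]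
      constructor <;> split_ifs <;> omega
    have fr := hf r (by simp)
    by_cases hpr : p = r
    · subst hpr
      exact .inr (.inl ⟨[], p, q, Z, rfl⟩)
    refine .inr (.inr ⟨u, v, List.isChain_cons_cons.2 ⟨?_, h⟩⟩)
    rw [List.isChain_cons_cons] at h hZ
    obtain ⟨⟨⟨g1, g2⟩, g3, g4⟩, -⟩ := hZ
    have hne3 : p.1 ≠ r.1 := fun e => hpr <| Prod.ext e <|
      levelWord_inj (by omega) (by omega) (by rw [← fp, ← fr, e])
    have hne4 : p.2 ≠ r.2 := fun e => hpr <| Prod.ext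
      (levelWord_inj (by omega) (by omega) (by rw [fp, fr, e])) e
    have h := h.1
    cases u <;> cases v <;> simp only [StepPair, if_true, if_false, Bool.false_eq_true] at h ⊢ <;>
      omega

/-- Two monotone walks that read the same word, the second starting near the end of the first,
agree: otherwise the word has a square if they run in the same direction, and a palindrome, hence
one of length two or three at its centre, if they run in opposite directions. -/
theorem eq_of_monotone {n : ℕ} {a b : ℕ → ℕ} (u v : Bool)
    (hu : ∀ i < n, if u then a i = a 0 + i else a i + i = a 0)
    (hv : ∀ i < n, if v then b i = b 0 + i else b i + i = b 0)
    (hf : ∀ i < n, levelWord (a i) = levelWord (b i)) (hl : Near (a (n - 1)) (b 0)) :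
    ∀ i < n, a i = b i := by
  intro i₀ hi₀
  obtain ⟨l1, l2⟩ := hl
  have hlast := hu (n - 1) (by omega)
  have hlast' := hv (n - 1) (by omega)
  obtain rfl | hn : n = 1 ∨ 2 ≤ n := by omega
  · obtain rfl : i₀ = 0 := by omega
    simp only [Nat.sub_self] at l1 l2
    exact levelWord_inj (by omega) (by omega) (hf 0 one_pos)
  cases u <;> cases v <;> simp only [if_true, if_false, Bool.false_eq_true] at hu hv hlast hlast'
  · by_cases h0 : a 0 = b 0
    · have := hu i₀ hi₀
      have := hv i₀ hi₀
      omega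
    refine absurd (fun i hi => ?_) (levelWord_squareFree (a 0 - b 0) (by omega)
      (b 0 + 1 - (a 0 - b 0)))
    have e1 := hu (a 0 - b 0 - 1 - i) (by omega)
    have e2 := hv (a 0 - b 0 - 1 - i) (by omega)
    have e3 := hf (a 0 - b 0 - 1 - i) (by omega)
    rw [show b 0 + 1 - (a 0 - b 0) + i = b (a 0 - b 0 - 1 - i) by omega, ← e3]
    congr 1
    omega
  · exfalso
    obtain ⟨c, hc | hc⟩ := Nat.even_or_odd' (a 0 + b 0)
    · by_cases h0 : a 0 = b 0
      · have e1 := hu 1 (by omega)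
        have e2 := hv 1 (by omega)
        have := levelWord_inj (by omega) (by omega) (hf 1 (by omega))
        omega
      · have e1 := hu (a 0 - c - 1) (by omega)
        have e2 := hv (a 0 - c - 1) (by omega)
        have := levelWord_inj (by omega) (by omega) (hf (a 0 - c - 1) (by omega))
        omega
    · have e1 := hu (a 0 - c - 1) (by omega)
      have e2 := hv (a 0 - c - 1) (by omega)
      have := levelWord_inj (by omega) (by omega) (hf (a 0 - c - 1) (by omega))
      omega
  · exfalso
    obtain ⟨c, hc | hc⟩ := Nat.even_or_odd' (a 0 + b 0)
    · by_cases h0 : a 0 = b 0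
      · have e1 := hu 1 (by omega)
        have e2 := hv 1 (by omega)
        have := levelWord_inj (by omega) (by omega) (hf 1 (by omega))
        omega
      · have e1 := hu (c - 1 - a 0) (by omega)
        have e2 := hv (c - 1 - a 0) (by omega)
        have := levelWord_inj (by omega) (by omega) (hf (c - 1 - a 0) (by omega))
        omega
    · have e1 := hu (c - a 0) (by omega)
      have e2 := hv (c - a 0) (by omega)
      have := levelWord_inj (by omega) (by omega) (hf (c - a 0) (by omega))
      omega
  · by_cases h0 : a 0 = b 0
    · have := hu i₀ hi₀
      have := hv i₀ hi₀
      omega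
    refine absurd (fun i hi => ?_) (levelWord_squareFree (b 0 - a 0) (by omega) (a 0))
    have e1 := hu i (by omega)
    have e2 := hv i (by omega)
    have e3 := hf i (by omega)
    rw [← e1, e3]
    congr 1
    omega

theorem eq_add_of_forall_step {n : ℕ} {a : ℕ → ℕ} (u : Bool)
    (h : ∀ i, i + 1 < n → if u then a (i + 1) = a i + 1 else a i = a (i + 1) + 1) :
    ∀ i < n, if u then a i = a 0 + i else a i + i = a 0 := by
  intro i hi
  induction i with
  | zero => simp
  | succ i ih =>
    have h1 := h i hi
    have h2 := ih (by omega)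
    cases u <;> simp only [if_true, if_false, Bool.false_eq_true] at * <;> omega

theorem fst_eq_snd_of_isChain_nearPair (Z : List (ℕ × ℕ))
    (hf : ∀ p ∈ Z, levelWord p.1 = levelWord p.2) (hZ : Z.IsChain NearPair)
    (hl : ∀ p ∈ Z.getLast?, ∀ q ∈ Z.head?, Near p.1 q.2) : ∀ p ∈ Z, p.1 = p.2 := by
  induction hn : Z.length using Nat.strong_induction_on generalizing Z with
  | _ n ih =>
    rcases reducible_or_monotone Z hf hZ with ⟨Z₁, p, Z₂, rfl⟩ | ⟨Z₁, p, q, Z₂, rfl⟩ | ⟨u, v, h⟩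
    · have key := ih (Z₁ ++ p :: Z₂).length (by simp at hn ⊢; omega) (Z₁ ++ p :: Z₂)
        (fun r hr => hf r (by simp at hr ⊢; tauto))
        (by
          rw [List.isChain_split] at hZ ⊢
          exact ⟨hZ.1, (List.isChain_cons_cons.1 hZ.2).2⟩)
        (by
          simpa [List.getLast?_append, List.getLast?_cons] using hl) rfl
      intro r hr
      exact key r (by simp at hr ⊢; tauto)
    · have hZ' := List.isChain_split.1 hZ
      have hpq := List.isChain_cons_cons.1 hZ'.2
      have key := ih (Z₁ ++ p :: Z₂).length (by simp at hn ⊢; omega) (Z₁ ++ p :: Z₂)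
        (fun r hr => hf r (by simp at hr ⊢; tauto))
        (List.isChain_split.2 ⟨hZ'.1, (List.isChain_cons_cons.1 hpq.2).2⟩)
        (by
          simpa [List.getLast?_append, List.getLast?_cons] using hl) rfl
      have hp := key p (by simp)
      have hq : q.1 = q.2 := by
        obtain ⟨⟨⟨h1, h2⟩, h3, h4⟩, -⟩ := hpq
        exact levelWord_inj (by omega) (by omega) (hf q (by simp))
      intro r hr
      by_cases hrq : r = q
      · rw [hrq, hq]
      exact key r (by simp at hr ⊢; tauto)
    · rw [List.isChain_iff_getElem] at h
      have hg : ∀ i (hi : i < Z.length), Z.getD i 0 = Z[i] := fun i hi => by simp [hi]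
      have hstep : ∀ i, i + 1 < Z.length → StepPair u v (Z.getD i 0) (Z.getD (i + 1) 0) :=
        fun i hi => by rw [hg i (by omega), hg _ hi]; exact h i hi
      intro p hp
      obtain ⟨i, hi, rfl⟩ := List.getElem_of_mem hp
      have := eq_of_monotone (n := Z.length) (a := fun i => (Z.getD i 0).1)
        (b := fun i => (Z.getD i 0).2) u v
        (eq_add_of_forall_step u fun i hi => (hstep i hi).1)
        (eq_add_of_forall_step v fun i hi => (hstep i hi).2)
        (fun i hi => by simp only [hg i hi]; exact hf _ (List.getElem_mem _))
        (by
          simp only [hg 0 (by omega), hg (Z.length - 1) (by omega)]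
          exact hl _ (by simp [List.getLast?_eq_getElem?]) _ (by simp [List.head?_eq_getElem?])) i hi
      simpa only [hg i hi] using this

/-- A lazy walk on the levels whose two halves read the same word visits the same levels in its two
halves. -/
theorem eq_of_isChain_near {A B : List ℕ} (hAB : (A ++ B).IsChain Near)
    (h : A.map levelWord = B.map levelWord) : A = B := by
  have hlen : A.length = B.length := by simpa using congrArg List.length h
  have hch := List.isChain_append.1 hAB
  have key := fst_eq_snd_of_isChain_nearPair (A.zip B) (fun p hp => by
      obtain ⟨i, hi, rfl⟩ := List.getElem_of_mem hp
      simp only [List.length_zip, lt_inf_iff] at hi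
      have := List.getElem_of_eq h (i := i) (by simpa using hi.1)
      simpa using this)
    (by
      rw [List.isChain_iff_getElem]
      intro i hi
      simp only [List.length_zip, lt_inf_iff] at hi
      simp only [List.getElem_zip]
      exact ⟨List.isChain_iff_getElem.1 hch.1 i hi.1, List.isChain_iff_getElem.1 hch.2.1 i hi.2⟩)
    (by
      intro p hp q hq
      rw [List.getLast?_eq_getElem?, Option.mem_def, List.getElem?_eq_some_iff] at hp
      rw [List.head?_eq_getElem?, Option.mem_def, List.getElem?_eq_some_iff] at hq
      obtain ⟨h1, rfl⟩ := hp
      obtain ⟨h2, rfl⟩ := hq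
      simp only [List.length_zip, lt_inf_iff] at h1 h2
      refine hch.2.2 _ ?_ _ ?_
      · simp [List.getLast?_eq_getElem?, hlen]
      · simp [List.head?_eq_getElem?])
  refine List.ext_getElem hlen fun i h1 h2 => ?_
  have := key ((A.zip B)[i]'(by simp; omega)) (List.getElem_mem _)
  simpa using this

/-! ### Levels of a graph built from cliques -/

/-- The level of the vertex `v` when every vertex `u` is joined to the vertices of `N u` before it:
one more than the least level in `N v`, or `0` if there is no vertex of `N v` before `v` (the
infimum of the empty set of naturals is `0`). -/
noncomputable def level (N : ℕ → Finset ℕ) (v : ℕ) : ℕ :=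
  sInf (Set.range fun u : {u // u ∈ N v ∧ u < v} => level N u.1 + 1)
termination_by v
decreasing_by exact u.2.2

/-- The sets of earlier neighbors in the graph that keeps only the edges within a level. -/
noncomputable def restrictLevel (N : ℕ → Finset ℕ) (v : ℕ) : Finset ℕ :=
  {u ∈ N v | u < v ∧ level N u = level N v}

theorem level_congr {N M : ℕ → Finset ℕ} {v : ℕ} (h : ∀ u ≤ v, N u = M u) :
    level N v = level M v := by
  induction v using Nat.strong_induction_on with
  | _ v ih =>
    rw [level, level, ← h v le_rfl]
    congr 2
    funext u
    rw [ih u u.2.2 fun w hw => h w (hw.trans u.2.2.le)]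

theorem restrictLevel_congr {N M : ℕ → Finset ℕ} {v : ℕ} (h : ∀ u ≤ v, N u = M u) :
    restrictLevel N v = restrictLevel M v := by
  ext u
  simp only [restrictLevel, Finset.mem_filter, h v le_rfl, level_congr h]
  refine and_congr_right fun _ => and_congr_right fun hu => ?_
  rw [level_congr fun w hw => h w (hw.trans hu.le)]

theorem level_iterate_congr (i : ℕ) {N M : ℕ → Finset ℕ} {v : ℕ} (h : ∀ u ≤ v, N u = M u) :
    level (restrictLevel^[i] N) v = level (restrictLevel^[i] M) v := by
  induction i generalizing N M with
  | zero => exact level_congr h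
  | succ i ih =>
    exact ih fun u hu => restrictLevel_congr fun w hw => h w (hw.trans hu)

/-- The adjacency relation of the graph in which each vertex `v` is joined to the earlier vertices
`N v`. -/
def BackAdj (N : ℕ → Finset ℕ) (u v : ℕ) : Prop := u ∈ N v ∨ v ∈ N u

/-- The sets `N v` describe the construction of a graph, vertex by vertex, where each new vertex is
joined to a clique with at most `k` vertices. -/
structure IsCliqueConstruction (k : ℕ) (N : ℕ → Finset ℕ) : Prop where
  lt : ∀ ⦃v u⦄, u ∈ N v → u < v
  clique : ∀ ⦃v a b⦄, a ∈ N v → b ∈ N v → a ≠ b → BackAdj N a b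
  card_le : ∀ v, (N v).card ≤ k

namespace IsCliqueConstruction

variable {k : ℕ} {N : ℕ → Finset ℕ}

theorem level_le_succ (hN : IsCliqueConstruction k N) {u v : ℕ} (h : u ∈ N v) :
    level N v ≤ level N u + 1 := by
  rw [level]
  exact Nat.sInf_le ⟨⟨u, h, hN.lt h⟩, rfl⟩

theorem exists_level_succ (hN : IsCliqueConstruction k N) {v : ℕ} (h : (N v).Nonempty) :
    ∃ u ∈ N v, level N v = level N u + 1 := by
  obtain ⟨w, hw⟩ := h
  have : (Set.range fun u : {u // u ∈ N v ∧ u < v} => level N u.1 + 1).Nonempty :=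
    ⟨_, ⟨w, hw, hN.lt hw⟩, rfl⟩
  obtain ⟨u, hu⟩ := Nat.sInf_mem this
  refine ⟨u, u.2.1, ?_⟩
  rw [level]
  exact hu.symm

/-- A vertex is joined only to vertices of its own level and of the level below, because they form
a clique and one of them is on the level below. -/
theorem level_le (hN : IsCliqueConstruction k N) {u v : ℕ} (h : u ∈ N v) :
    level N u ≤ level N v := by
  induction v using Nat.strong_induction_on with
  | _ v ih =>
    obtain ⟨z, hz, hlz⟩ := hN.exists_level_succ ⟨u, h⟩
    by_cases huz : u = z
    · rw [huz]; omega
    rcases hN.clique h hz huz with h1 | h1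
    · have := ih z (hN.lt hz) h1
      omega
    · have := hN.level_le_succ h1
      omega

theorem near_level (hN : IsCliqueConstruction k N) {u v : ℕ} (h : BackAdj N u v) :
    Near (level N u) (level N v) := by
  rcases h with h | h <;> have h1 := hN.level_le h <;> have h2 := hN.level_le_succ h <;>
    constructor <;> omega

theorem restrictLevel (hN : IsCliqueConstruction (k + 1) N) :
    IsCliqueConstruction k (restrictLevel N) where
  lt v u h := hN.lt (Finset.mem_filter.1 h).1
  clique v a b ha hb hab := by
    obtain ⟨ha, -, la⟩ := Finset.mem_filter.1 ha
    obtain ⟨hb, -, lb⟩ := Finset.mem_filter.1 hb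
    exact (hN.clique ha hb hab).imp
      (fun h => Finset.mem_filter.2 ⟨h, hN.lt h, la.trans lb.symm⟩)
      (fun h => Finset.mem_filter.2 ⟨h, hN.lt h, lb.trans la.symm⟩)
  card_le v := by
    rcases (N v).eq_empty_or_nonempty with h | h
    · simp [_root_.restrictLevel, h]
    · obtain ⟨z, hz, hl⟩ := hN.exists_level_succ h
      have hss : _root_.restrictLevel N v ⊂ N v := by
        refine (Finset.ssubset_iff_of_subset (Finset.filter_subset _ _)).2 ⟨z, hz, fun hz' => ?_⟩
        have := (Finset.mem_filter.1 hz').2.2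
        omega
      have := Finset.card_lt_card hss
      have := hN.card_le v
      omega

/-- On a path on levels `≥ d`, the vertices of level `d` form a path in the graph of that level.
Indeed the latest vertex `w` of a higher level can be left out of the path: its neighbors on the
path came before `w`, so they belong to the clique to which `w` was joined. -/
theorem isChain_filter_level (hN : IsCliqueConstruction k N) (d : ℕ) (p : List ℕ)
    (hp : p.Nodup) (hc : p.IsChain (BackAdj N)) (hd : ∀ v ∈ p, d ≤ level N v) :
    (p.filter fun v => level N v = d).IsChain (BackAdj (_root_.restrictLevel N)) := by
  induction hn : p.length using Nat.strong_induction_on generalizing p with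
  | _ n ih =>
    by_cases hex : ∃ v ∈ p, d < level N v
    · obtain ⟨w, hw, hmax⟩ := (p.toFinset.filter (d < level N ·)).exists_max_image id
        (by obtain ⟨v, hv, hdv⟩ := hex; exact ⟨v, by simp [hv, hdv]⟩)
      simp only [Finset.mem_filter, List.mem_toFinset, id] at hw hmax
      obtain ⟨hwp, hdw⟩ := hw
      have hback : ∀ x ∈ p, BackAdj N x w → x ∈ N w := by
        intro x hx hxw
        rcases hxw with h | h
        · exact h
        · have h1 := hN.level_le h
          have h2 := hmax x ⟨hx, by omega⟩
          have h3 := hN.lt h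
          omega
      obtain ⟨A, B, rfl⟩ := List.append_of_mem hwp
      have hfil : (A ++ w :: B).filter (fun v => level N v = d)
          = (A ++ B).filter (fun v => level N v = d) := by
        simp [List.filter_append, hdw.ne']
      have hsub : (A ++ B).Sublist (A ++ w :: B) :=
        List.Sublist.append_left (List.sublist_cons_self _ _) _
      rw [hfil]
      refine ih (A ++ B).length (by simp at hn ⊢; omega) (A ++ B) (hp.sublist hsub) ?_
        (fun v hv => hd v (hsub.subset hv)) rfl
      rw [List.isChain_append] at hc ⊢
      refine ⟨hc.1, hc.2.1.tail, fun x hx y hy => ?_⟩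
      have hxA := List.mem_of_getLast? hx
      have hyB := List.mem_of_head? hy
      have hxw : BackAdj N x w := hc.2.2 x hx w rfl
      have hwy : BackAdj N w y := by
        have := hc.2.1
        rw [List.isChain_cons] at this
        exact this.1 y hy
      have hxy : x ≠ y := by
        rintro rfl
        exact (List.nodup_append.1 hp).2.2 x hxA x (List.mem_cons_of_mem _ hyB) rfl
      exact hN.clique (hback x (by simp [hxA]) hxw) (hback y (by simp [hyB]) hwy.symm) hxy
    · push Not at hex
      have hl : ∀ v ∈ p, level N v = d := fun v hv => le_antisymm (hex v hv) (hd v hv)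
      rw [List.filter_eq_self.2 (by simpa using hl)]
      refine hc.imp_of_mem_imp fun x y hx hy h => ?_
      have e : level N x = level N y := (hl x hx).trans (hl y hy).symm
      exact h.imp (fun h => Finset.mem_filter.2 ⟨h, hN.lt h, e⟩)
        (fun h => Finset.mem_filter.2 ⟨h, hN.lt h, e.symm⟩)

/-- Colors record the letters of the level of a vertex, of its level within the graph of its level,
and so on `k` times. If the two halves of a path are colored in the same way then they visit the same
levels at the same times, so the part of the path on its lowest level is again a path whose two
halves are colored in the same way, in a graph constructed from cliques with one vertex less. -/
theorem eq_nil_of_forall₂ (hN : IsCliqueConstruction k N) {P Q : List ℕ} (hnd : (P ++ Q).Nodup)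
    (hc : (P ++ Q).IsChain (BackAdj N))
    (h : List.Forall₂ (fun x y => ∀ i < k, levelWord (level (_root_.restrictLevel^[i] N) x)
      = levelWord (level (_root_.restrictLevel^[i] N) y)) P Q) : P = [] := by
  induction k generalizing N P Q with
  | zero =>
    have hempty : ∀ v, N v = ∅ := fun v => Finset.card_eq_zero.1 (Nat.le_zero.1 (hN.card_le v))
    rcases P with _ | ⟨x, P⟩
    · rfl
    rcases Q with _ | ⟨y, Q⟩
    · cases h
    obtain ⟨z, hz⟩ : ∃ z, z ∈ (x :: P).getLast? := ⟨_, List.getLast?_eq_some_getLast (by simp)⟩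
    have := (List.isChain_append.1 hc).2.2 z hz y rfl
    simp [BackAdj, hempty] at this
  | succ k ih =>
    by_contra hP
    have hlev : P.map (level N) = Q.map (level N) := by
      refine eq_of_isChain_near ?_ ?_
      · rw [← List.map_append, List.isChain_map]
        exact hc.imp fun _ _ => hN.near_level
      · rw [← List.forall₂_eq_eq_eq, List.map_map, List.map_map, List.forall₂_map_left_iff,
          List.forall₂_map_right_iff]
        exact h.imp fun x y hxy => hxy 0 k.succ_pos
    have hlev₂ : List.Forall₂ (fun x y => level N x = level N y) P Q := by
      rwa [← List.forall₂_eq_eq_eq, List.forall₂_map_left_iff, List.forall₂_map_right_iff] at hlev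
    obtain ⟨m, hm, hmin⟩ := P.toFinset.exists_min_image (level N)
      (by simpa [List.toFinset_nonempty_iff] using hP)
    simp only [List.mem_toFinset] at hm hmin
    have hd : ∀ v ∈ P ++ Q, level N m ≤ level N v := by
      intro v hv
      rcases List.mem_append.1 hv with hv | hv
      · exact hmin v hv
      · obtain ⟨w, hw, he⟩ := List.mem_map.1
          (show level N v ∈ P.map (level N) from hlev ▸ List.mem_map_of_mem hv)
        rw [← he]
        exact hmin w hw
    have hchain := hN.isChain_filter_level (level N m) _ hnd hc hd
    have hnd' := hnd.filter fun v => level N v = level N m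
    rw [List.filter_append] at hchain hnd'
    have hboth : List.Forall₂ (fun x y => level N x = level N y ∧
        ∀ i < k, levelWord (level (_root_.restrictLevel^[i] (_root_.restrictLevel N)) x)
          = levelWord (level (_root_.restrictLevel^[i] (_root_.restrictLevel N)) y)) P Q := by
      rw [List.forall₂_iff_get] at h hlev₂ ⊢
      exact ⟨h.1, fun j h1 h2 => ⟨hlev₂.2 j h1 h2, fun i hi => h.2 j h1 h2 (i + 1) (by omega)⟩⟩
    have hfil := List.rel_filter (p := fun v => decide (level N v = level N m))
      (q := fun v => decide (level N v = level N m)) (fun x y hxy => by simp [hxy.1]) hboth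
    have := ih hN.restrictLevel hnd' hchain (hfil.imp fun x y hxy => hxy.2)
    have hmem : m ∈ P.filter fun v => level N v = level N m := by simp [hm]
    rw [this] at hmem
    simp at hmem

end IsCliqueConstruction

/-! ### The coloring strategy for online k-trees -/

/-- The color of a vertex: the letters of its level, of its level within the graph of its level, and
so on, `k` letters in all. -/
noncomputable def levelColor (k : ℕ) (N : ℕ → Finset ℕ) (v : ℕ) : Fin (4 ^ k) :=
  finFunctionFinEquiv fun i : Fin k => ⟨levelWord (level (restrictLevel^[i] N) v), levelWord_lt _⟩

theorem levelColor_congr (k : ℕ) {N M : ℕ → Finset ℕ} {v : ℕ} (h : ∀ u ≤ v, N u = M u) :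
    levelColor k N v = levelColor k M v := by
  simp only [levelColor, level_iterate_congr _ h]

theorem levelWord_eq_of_levelColor_eq {k : ℕ} {N : ℕ → Finset ℕ} {x y : ℕ}
    (h : levelColor k N x = levelColor k N y) :
    ∀ i < k, levelWord (level (restrictLevel^[i] N) x)
      = levelWord (level (restrictLevel^[i] N) y) := fun i hi => by
  simpa using congrFun (finFunctionFinEquiv.injective h) ⟨i, hi⟩

theorem List.IsChain.exists_rel {α : Type*} {R : α → α → Prop} {l : List α} (h : l.IsChain R)
    (hl : 2 ≤ l.length) {x : α} (hx : x ∈ l) : ∃ y, R x y ∨ R y x := by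
  obtain ⟨A, B, rfl⟩ := List.append_of_mem hx
  rcases B with _ | ⟨y, B⟩
  · rcases List.eq_nil_or_concat A with rfl | ⟨A, y, rfl⟩
    · simp at hl
    · exact ⟨y, .inr ((List.isChain_append.1 h).2.2 y (by simp) x rfl)⟩
  · exact ⟨y, .inl (List.isChain_cons_cons.1 (List.isChain_append.1 h).2.1).1⟩

/-- The sets of earlier neighbors in a `k`-tree process with the steps `S`. The initial complete
graph counts as built vertex by vertex as well. -/
def backNbrs (k : ℕ) (S : ℕ → OnlineStep) (v : ℕ) : Finset ℕ :=
  if v < k + 1 then Finset.range v else (S (v - (k + 1))).nbrs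

/-- The sets of earlier neighbors in the graph on the vertices `0, …, n - 1`. -/
def backNbrsBelow (k : ℕ) (S : ℕ → OnlineStep) (n v : ℕ) : Finset ℕ :=
  if v < n then backNbrs k S v else ∅

theorem backNbrsBelow_subset (k : ℕ) (S : ℕ → OnlineStep) (n v : ℕ) :
    backNbrsBelow k S n v ⊆ backNbrsBelow k S (n + 1) v := by
  unfold backNbrsBelow
  split_ifs with h1 h2
  · rfl
  · omega
  · simp
  · simp

theorem backNbrsBelow_succ_self (k : ℕ) (S : ℕ → OnlineStep) (t : ℕ) :
    backNbrsBelow k S (k + 1 + t + 1) (k + 1 + t) = (S t).nbrs := by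
  rw [backNbrsBelow, if_pos (by omega), backNbrs, if_neg (by omega), Nat.add_sub_cancel_left]

theorem backAdj_of_onlineGraph_adj {k t : ℕ} {S : ℕ → OnlineStep} {u v : ℕ}
    (h : (onlineGraph (k + 1) (initialComplete (k + 1)) S t).Adj u v) :
    BackAdj (backNbrsBelow k S (k + 1 + t)) u v := by
  induction t with
  | zero =>
    obtain ⟨hne, hu, hv⟩ := h
    rcases lt_or_gt_of_ne hne with h | h
    · exact .inl (by simp [backNbrsBelow, backNbrs, hv, h])
    · exact .inr (by simp [backNbrsBelow, backNbrs, hu, h])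
  | succ t ih =>
    rw [onlineGraph, extendGraph, SimpleGraph.sup_adj, SimpleGraph.fromRel_adj] at h
    have hnew := backNbrsBelow_succ_self k S t
    rcases h with h | ⟨-, ⟨rfl, h⟩ | ⟨rfl, h⟩⟩
    · exact (ih (SimpleGraph.deleteEdges_le _ h)).imp
        (fun h => backNbrsBelow_subset k S _ _ h) (fun h => backNbrsBelow_subset k S _ _ h)
    · exact .inr (hnew ▸ h)
    · exact .inl (hnew ▸ h)

theorem isCliqueConstruction_backNbrsBelow {k t : ℕ} {S : ℕ → OnlineStep}
    (h : ∀ i < t, IsLegalStep (KTreeStep k) (k + 1 + i)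
      (onlineGraph (k + 1) (initialComplete (k + 1)) S i) (S i)) :
    IsCliqueConstruction k (backNbrsBelow k S (k + 1 + t)) := by
  induction t with
  | zero =>
    refine ⟨fun v u hu => ?_, fun v a b ha hb hab => ?_, fun v => ?_⟩
    · simp only [backNbrsBelow, backNbrs] at hu
      split_ifs at hu <;> simp_all
    · simp only [backNbrsBelow, backNbrs, BackAdj, add_zero] at ha hb ⊢
      split_ifs at ha hb
      · simp only [Finset.mem_range] at ha hb
        rw [if_pos (by omega), if_pos (by omega), if_pos (by omega), if_pos (by omega)]
        simp only [Finset.mem_range]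
        omega
      · simp at ha
    · by_cases hv : v < k + 1
      · simp only [backNbrsBelow, backNbrs, add_zero, hv, if_true, Finset.card_range]
        omega
      · simp [backNbrsBelow, hv]
  | succ t ih =>
    have ih := ih fun i hi => h i (by omega)
    obtain ⟨hsub, -, hclique, -⟩ := h t (by omega)
    have hnew := backNbrsBelow_succ_self k S t
    have hold : ∀ v ≠ k + 1 + t,
        backNbrsBelow k S (k + 1 + t + 1) v = backNbrsBelow k S (k + 1 + t) v := by
      intro v hv
      simp only [backNbrsBelow, show v < k + 1 + t + 1 ↔ v < k + 1 + t by omega]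
    have hmono : ∀ {a b}, BackAdj (backNbrsBelow k S (k + 1 + t)) a b →
        BackAdj (backNbrsBelow k S (k + 1 + t + 1)) a b := fun h =>
      h.imp (fun h => backNbrsBelow_subset k S _ _ h) (fun h => backNbrsBelow_subset k S _ _ h)
    rw [← add_assoc]
    refine ⟨fun v u hu => ?_, fun v a b ha hb hab => ?_, fun v => ?_⟩ <;>
      obtain rfl | hv := eq_or_ne v (k + 1 + t)
    · rw [hnew] at hu
      exact Finset.mem_range.1 (hsub hu)
    · exact ih.lt (hold v hv ▸ hu)
    · rw [hnew] at ha hb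
      exact hmono (backAdj_of_onlineGraph_adj (hclique.isClique ha hb hab))
    · exact hmono (ih.clique (hold v hv ▸ ha) (hold v hv ▸ hb) hab)
    · rw [hnew]
      exact hclique.card_eq.le
    · rw [hold v hv]
      exact ih.card_le v

/-- The strategy that colors by levels. The steps after the given history are irrelevant for the
color of the last vertex, and are filled in without neighbors. -/
noncomputable def levelStrategy (k : ℕ) : OnlineStrategy (k + 1) (Fin (4 ^ k)) where
  init v := levelColor k Finset.range v
  respond L := levelColor k (backNbrs k fun i => L.getD i ⟨∅, ∅⟩) (k + L.length)

theorem levelStrategy_coloring (k : ℕ) (S : ℕ → OnlineStep) (v : ℕ) :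
    (levelStrategy k).coloring S v = levelColor k (backNbrs k S) v := by
  unfold OnlineStrategy.coloring
  split_ifs with hv
  · exact levelColor_congr k fun u hu => by rw [backNbrs, if_pos (by omega)]
  · simp only [levelStrategy, List.length_map, List.length_range]
    rw [show k + (v - (k + 1) + 1) = v by omega]
    refine levelColor_congr k fun u hu => ?_
    simp only [backNbrs]
    split_ifs with h
    · rfl
    · rw [List.getD_eq_getElem _ _ (by simp; omega)]
      simp

theorem theorem1 (k : ℕ) :
    OnlineNonrepetitivelyColorable (k + 1) (initialComplete (k + 1)) (KTreeStep k)
      (Fin (4 ^ k)) := by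
  refine ⟨levelStrategy k, fun S t hS u v p hp => ?_⟩
  rintro ⟨w, hw, hrep⟩
  have hN := isCliqueConstruction_backNbrsBelow hS
  have hchain : p.support.IsChain (BackAdj (backNbrsBelow k S (k + 1 + t))) :=
    p.isChain_adj_support.imp fun _ _ => backAdj_of_onlineGraph_adj
  obtain ⟨P, Q, hPQ, hP, hQ⟩ := List.map_eq_append_iff.1 hrep
  have hlen : P.length = Q.length := by
    simpa using congrArg List.length (hP.trans hQ.symm)
  have hPne : P ≠ [] := by
    rintro rfl
    exact hw (by simpa using hP.symm)
  have hlen₂ : 2 ≤ p.support.length := by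
    have := List.length_pos_iff.2 hPne
    rw [hPQ, List.length_append]
    omega
  -- A vertex that has not arrived yet is isolated, so it does not lie on the path.
  have harrived : ∀ x ∈ p.support, x < k + 1 + t := by
    intro x hx
    obtain ⟨y, h⟩ := hchain.exists_rel hlen₂ hx
    have key : ∀ {a b}, a ∈ backNbrsBelow k S (k + 1 + t) b → b < k + 1 + t := by
      intro a b hab
      by_contra hb
      simp [backNbrsBelow, hb] at hab
    rcases h with (h | h) | (h | h)
    · exact (hN.lt h).trans (key h)
    · exact key h
    · exact key h
    · exact (hN.lt h).trans (key h)
  have hcolor : ∀ x ∈ p.support, (levelStrategy k).coloring S x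
      = levelColor k (backNbrsBelow k S (k + 1 + t)) x := by
    intro x hx
    rw [levelStrategy_coloring]
    refine levelColor_congr k fun u hu => ?_
    rw [backNbrsBelow, if_pos (hu.trans_lt (harrived x hx))]
  refine hPne (hN.eq_nil_of_forall₂ (P := P) (Q := Q) (hPQ ▸ hp.support_nodup) (hPQ ▸ hchain) ?_)
  rw [List.forall₂_iff_get]
  refine ⟨hlen, fun i h1 h2 => levelWord_eq_of_levelColor_eq ?_⟩
  have hi := List.getElem_of_eq (hP.trans hQ.symm) (i := i) (by simpa using h1)
  rw [List.getElem_map, List.getElem_map] at hi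
  rw [← hcolor _ (by rw [hPQ]; exact List.mem_append_left _ (List.get_mem _ _)),
    ← hcolor _ (by rw [hPQ]; exact List.mem_append_right _ (List.get_mem _ _))]
  exact hi
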